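/- **Theorem 2.** A Gaussian channel with synchronization errors takes an input sequence $(x[1],\dots,x[T])\in\mathbb R^T$, repeats the symbol $x[t]$ in place $s[t]\in\{0,1,2,\dots\}$ times, where $s[1],\dots,s[T]$ are i.i.d. (an insertion/deletion process), and adds i.i.d. $\mathcal N(0,\eta^2)$ noise to every symbol of the resulting sequence, whose length $L=\sum_t s[t]$ is random; the receiver observes the noisy sequence (and hence $L$), but not the states $s[t]$. For a class of such channels, a rate $\hat R$ per unit energy is achievable if for every $\varepsilon>0$ and every large enough $M$ there are a block length $T$, a number $P>0$, $M$ codewords in $\mathbb R^T$ of energy $\sum_t x_m[t]^2\le P$ each, and a decoder, such that $\log_2(M)/P\ge\hat R$ and such that the average probability of decoding error (equiprobable messages) of this one encoder/decoder pair is at most $\varepsilon$ over every channel of the class. The compound capacity per unit energy of the class is the supremum of the achievable rates. Let $0<\mu_1\le\mu_2$, $\sigma\in\mathbb R$ and $\eta>0$, and suppose that there is a probability distribution on $\{0,1,2,\dots\}$ with mean $\mu_1$ and variance at most $\sigma^2$. Then the class of all Gaussian channels with synchronization errors that have noise power $\eta^2$ and an insertion/deletion process with mean $\mathbb E(s[1])\in[\mu_1,\mu_2]$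 and variance $\operatorname{var}(s[1])\le\sigma^2$ has compound capacity per unit energy $$\hat C\bigl([\mu_1,\mu_2],[0,\sigma^2],\mathcal N(0,\eta^2)\bigr)=\frac{\mu_1}{2\eta^2\ln 2},$$ and this equals the capacity per unit energy of the worst channel in the class: it is the minimum, over all channels in the class, of the capacity per unit energy of that single channel with its statistics known. -/

import Mathlib

open MeasureTheory ProbabilityTheory
open scoped ENNReal NNReal

noncomputable section

namespace SyncChannel

/-- Total number of symbols at the output of the insertion/deletion channel (IDC) when input
symbol number `t` is repeated `s t` times. -/
def outputLength {T : ℕ} (s : Fin T → ℕ) : ℕ := ∑ t, s t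

theorem sampleTime_nonempty {T : ℕ} (s : Fin T → ℕ) (l : Fin (outputLength s)) :
    (Finset.univ.filter fun t : Fin T => l.val < ∑ j ∈ Finset.Iic t, s j).Nonempty := by
  obtain ⟨l, hl⟩ := l
  rcases T with _ | T
  · simp [outputLength] at hl
  · refine ⟨Fin.last T, ?_⟩
    have h : (Finset.Iic (Fin.last T)) = Finset.univ := by
      ext t
      simp [Fin.le_last]
    simpa [h, outputLength] using hl

/-- The sampling time `t[l] = min {t : s[1] + ⋯ + s[t] ≥ l}`. Output positions are counted from
`0` in the code, whence the strict inequality. -/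
def sampleTime {T : ℕ} (s : Fin T → ℕ) (l : Fin (outputLength s)) : Fin T :=
  (Finset.univ.filter fun t : Fin T => l.val < ∑ j ∈ Finset.Iic t, s j).min'
    (sampleTime_nonempty s l)

/-- The output sequence of the IDC for the input `x` and the state sequence `s`. -/
def idcOutput {T : ℕ} (x : Fin T → ℝ) (s : Fin T → ℕ) : Fin (outputLength s) → ℝ :=
  fun l => x (sampleTime s l)

/-- The law of the i.i.d. state sequence of length `T`, each state having law `ν`. -/
def stateLaw (ν : ProbabilityMeasure ℕ) (T : ℕ) : Measure (Fin T → ℕ) :=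
  Measure.pi fun _ => (ν : Measure ℕ)

/-- The conditional law of the channel output given the state sequence `s`: independent Gaussian
noise of mean zero and variance `η ^ 2` is added to every output symbol of the IDC. -/
def noisyOutput {T : ℕ} (η : ℝ≥0) (x : Fin T → ℝ) (s : Fin T → ℕ) :
    Measure (Fin (outputLength s) → ℝ) :=
  Measure.pi fun l => gaussianReal (idcOutput x s l) (η ^ 2)

/-- Signal energy of an input sequence. -/
def energy {T : ℕ} (x : Fin T → ℝ) : ℝ := ∑ t, x t ^ 2

/-- A code with block length `T` and `M` messages. Since the length of the received sequence is
random, the decoder consists of one sub-decoder for each possible length; it sees the received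
sequence (hence its length), but not the states of the IDC. -/
structure Code (T M : ℕ) where
  codeword : Fin M → Fin T → ℝ
  decoder : (n : ℕ) → (Fin n → ℝ) → Fin M
  measurable_decoder : ∀ n, Measurable (decoder n)

/-- The probability of decoding error when message `m` is sent over the Gaussian channel with
synchronization errors with state law `ν` and noise power `η ^ 2`. -/
def Code.errorProb {T M : ℕ} (C : Code T M) (ν : ProbabilityMeasure ℕ) (η : ℝ≥0) (m : Fin M) :
    ℝ≥0∞ :=
  ∫⁻ s, noisyOutput η (C.codeword m) s {y | C.decoder (outputLength s) y ≠ m} ∂(stateLaw ν T)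

/-- The average probability of decoding error for equiprobable messages. -/
def Code.avgErrorProb {T M : ℕ} (C : Code T M) (ν : ProbabilityMeasure ℕ) (η : ℝ≥0) : ℝ≥0∞ :=
  (∑ m, C.errorProb ν η m) / (M : ℝ≥0∞)

/-- `C` is a `(T, M, P, ε)` code for the compound channel: every codeword has energy at most `P`,
and the average probability of error is at most `ε` over every channel whose state law is in `S`
(one and the same encoder and decoder for all of them). -/
def Code.IsGood {T M : ℕ} (C : Code T M) (S : Set (ProbabilityMeasure ℕ)) (η : ℝ≥0) (P ε : ℝ) :
    Prop :=
  (∀ m, energy (C.codeword m) ≤ P) ∧ ∀ ν ∈ S, C.avgErrorProb ν η ≤ ENNReal.ofReal ε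

/-- The rate `R` (in bits) per unit energy is achievable: for every `ε > 0` and every large enough
`M` there is a `(T, M, P, ε)` code with `log₂ M / P ≥ R`. -/
def Achievable (S : Set (ProbabilityMeasure ℕ)) (η : ℝ≥0) (R : ℝ) : Prop :=
  ∀ ε : ℝ, 0 < ε → ∃ M₀ : ℕ, ∀ M : ℕ, M₀ ≤ M →
    ∃ (T : ℕ) (P : ℝ) (C : Code T M), 0 < P ∧ C.IsGood S η P ε ∧ R ≤ Real.logb 2 M / P

/-- The compound capacity per unit energy, in bits, of the class of Gaussian channels with
synchronization errors whose state law is in `S` and whose noise power is `η ^ 2`: the supremum of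
the achievable rates, as an extended real number. For `S = {ν}` it is the capacity per unit energy
of the channel with the known state law `ν`. -/
def capacityPerUnitEnergy (S : Set (ProbabilityMeasure ℕ)) (η : ℝ≥0) : EReal :=
  sSup ((fun R : ℝ => (R : EReal)) '' {R : ℝ | Achievable S η R})

/-- The insertion/deletion processes (laws of one state) with finite mean in `U` and finite
variance in `V`. -/
def idcClass (U V : Set ℝ) : Set (ProbabilityMeasure ℕ) :=
  {ν | MemLp (fun k : ℕ => (k : ℝ)) 2 (ν : Measure ℕ) ∧
    (∫ k, (k : ℝ) ∂(ν : Measure ℕ)) ∈ U ∧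
    variance (fun k : ℕ => (k : ℝ)) (ν : Measure ℕ) ∈ V}

end SyncChannel

end

/-! Converse, for one channel with state mean `μ`. Given the states, the output length is the same
for every message, so the output law of each codeword can be compared with pure noise of that
length. The relative entropy is `∑ s t * x t ^ 2 / (2 η²)`, whose mean over the states is at most `μ
P / (2 η²)`. The decoding sets partition the output space, so their pure-noise probabilities sum to
one. Applying the entropy inequality `mul_pi_gaussianReal_le` to each of them and averaging over
messages and states gives the Fano-type bound `Code.IsGood.log_card_le`, hence `R ≤ μ / (2 η² ln
2)`.

Achievability uses pulse position coding with blocks of `K` symbols, `K` chosen after `M`. At fixed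
energy `P` the pulse has height `√(P / K)`. By Chebyshev, block boundaries drift by about `√(M K)`
output positions, negligible against the output length of a block, of order `K`
(`stateLaw_deviating_le`). Windows of length `L / M` therefore nearly coincide with the blocks, and
the decoder needs only `L`, not the state law. A false alarm in one window has probability about
`exp (-P μ₁ / (2 η²))`, and a union bound over `M` windows suffices when `ln M` is below this
exponent (`EvenlySpread.measureReal_decoder_ne_le`, `achievable_idcClass`).

A channel of mean `μ₁` in the class makes the two bounds meet. -/

noncomputable section

namespace SyncChannel

section

/-! ### Change of measure between Gaussian laws -/

/-- The log-likelihood ratio of `gaussianReal u v` with respect to `gaussianReal 0 v`. -/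
def gaussianLLR (v : ℝ≥0) (u y : ℝ) : ℝ := u * y / v - u ^ 2 / (2 * v)

theorem measurable_gaussianLLR (v : ℝ≥0) (u : ℝ) : Measurable (gaussianLLR v u) := by
  unfold gaussianLLR
  fun_prop

theorem gaussianReal_zero_eq_withDensity (u : ℝ) {v : ℝ≥0} (hv : v ≠ 0) :
    gaussianReal 0 v =
      (gaussianReal u v).withDensity fun y => ENNReal.ofReal (Real.exp (-gaussianLLR v u y)) := by
  have hm : Measurable fun y => ENNReal.ofReal (Real.exp (-gaussianLLR v u y)) := by
    have := measurable_gaussianLLR v u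
    fun_prop
  rw [gaussianReal_of_var_ne_zero _ hv, gaussianReal_of_var_ne_zero _ hv,
    ← withDensity_mul _ (measurable_gaussianPDF u v) hm]
  congr 1
  funext y
  have hv' : (v : ℝ) ≠ 0 := by exact_mod_cast hv
  simp only [gaussianPDF, Pi.mul_apply]
  rw [← ENNReal.ofReal_mul (gaussianPDFReal_nonneg _ _ _)]
  congr 1
  simp only [gaussianPDFReal_def]
  rw [mul_assoc (√(2 * Real.pi * v))⁻¹, ← Real.exp_add]
  congr 2
  unfold gaussianLLR
  field_simp
  ring

theorem integrable_exp_neg_gaussianLLR (u : ℝ) (v : ℝ≥0) :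
    Integrable (fun y => Real.exp (-gaussianLLR v u y)) (gaussianReal u v) := by
  have h := (integrable_exp_mul_gaussianReal (μ := u) (v := v) (-(u / v))).const_mul
    (Real.exp (u ^ 2 / (2 * v)))
  refine h.congr (ae_of_all _ fun y => ?_)
  simp only
  rw [← Real.exp_add]
  congr 1
  unfold gaussianLLR
  ring

theorem integrable_id_gaussianReal (u : ℝ) (v : ℝ≥0) :
    Integrable (fun y => y) (gaussianReal u v) :=
  (memLp_id_gaussianReal (μ := u) (v := v) 1).integrable le_rfl

theorem integral_gaussianLLR (u : ℝ) {v : ℝ≥0} (hv : v ≠ 0) :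
    ∫ y, gaussianLLR v u y ∂gaussianReal u v = u ^ 2 / (2 * v) := by
  have hv' : (v : ℝ) ≠ 0 := by exact_mod_cast hv
  have h : ∀ y, gaussianLLR v u y = u / v * y - u ^ 2 / (2 * v) := fun y => by
    unfold gaussianLLR; ring
  simp only [h]
  rw [integral_sub ((integrable_id_gaussianReal u v).const_mul _) (integrable_const _),
    integral_const_mul, integral_id_gaussianReal]
  simp
  field_simp
  ring

theorem integrable_gaussianLLR (u : ℝ) (v : ℝ≥0) :
    Integrable (gaussianLLR v u) (gaussianReal u v) := by
  have h : gaussianLLR v u = fun y => u / v * y - u ^ 2 / (2 * v) := by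
    funext y; unfold gaussianLLR; ring
  rw [h]
  exact ((integrable_id_gaussianReal u v).const_mul _).sub (integrable_const _)

variable {ι : Type*} [Fintype ι]

theorem integrable_exp_neg_sum_gaussianLLR (u : ι → ℝ) (v : ℝ≥0) :
    Integrable (fun y : ι → ℝ => Real.exp (-∑ i, gaussianLLR v (u i) (y i)))
      (Measure.pi fun i => gaussianReal (u i) v) := by
  have h := Integrable.fintype_prod (μ := fun i => gaussianReal (u i) v)
    (f := fun i y => Real.exp (-gaussianLLR v (u i) y))
    fun i => integrable_exp_neg_gaussianLLR (u i) v
  refine h.congr (ae_of_all _ fun y => ?_)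
  simp only
  rw [← Real.exp_sum, Finset.sum_neg_distrib]

theorem pi_gaussianReal_zero_eq_withDensity (u : ι → ℝ) {v : ℝ≥0} (hv : v ≠ 0) :
    (Measure.pi fun _ : ι => gaussianReal 0 v) =
      (Measure.pi fun i => gaussianReal (u i) v).withDensity
        fun y => ENNReal.ofReal (Real.exp (-∑ i, gaussianLLR v (u i) (y i))) := by
  refine Measure.pi_eq (μ := fun _ : ι => gaussianReal 0 v) fun s hs => ?_
  rw [withDensity_apply _ (MeasurableSet.univ_pi hs), Measure.restrict_pi_pi]
  have hi : ∀ i, Integrable (fun y => Real.exp (-gaussianLLR v (u i) y))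
      ((gaussianReal (u i) v).restrict (s i)) :=
    fun i => (integrable_exp_neg_gaussianLLR (u i) v).restrict
  have hp := Integrable.fintype_prod (μ := fun i => (gaussianReal (u i) v).restrict (s i))
    (f := fun i y => Real.exp (-gaussianLLR v (u i) y)) hi
  simp only [← Finset.sum_neg_distrib, Real.exp_sum]
  rw [← ofReal_integral_eq_lintegral_ofReal hp
    (ae_of_all _ fun y => Finset.prod_nonneg fun i _ => (Real.exp_pos _).le),
    integral_fintype_prod_eq_prod (μ := fun i => (gaussianReal (u i) v).restrict (s i))
      (fun i y => Real.exp (-gaussianLLR v (u i) y)),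
    ENNReal.ofReal_prod_of_nonneg
      fun i _ => integral_nonneg fun y => (Real.exp_pos _).le]
  refine Finset.prod_congr rfl fun i _ => ?_
  rw [ofReal_integral_eq_lintegral_ofReal (hi i) (ae_of_all _ fun y => (Real.exp_pos _).le),
    gaussianReal_zero_eq_withDensity (u i) hv, withDensity_apply _ (hs i)]

/-- A weak data processing inequality: the probability of an event under a shifted Gaussian law is
controlled by its probability under the centred one and by the relative entropy. -/
theorem mul_pi_gaussianReal_le (u : ι → ℝ) {v : ℝ≥0} (hv : v ≠ 0) {A : Set (ι → ℝ)}
    (hA : MeasurableSet A) (c : ℝ) :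
    c * (Measure.pi fun i => gaussianReal (u i) v).real A ≤
      (∑ i, u i ^ 2) / (2 * v) +
        (Real.exp c - 1) * (Measure.pi fun _ : ι => gaussianReal 0 v).real A := by
  set P := Measure.pi fun i => gaussianReal (u i) v with hP
  set Q := Measure.pi fun _ : ι => gaussianReal 0 v with hQ
  set L : (ι → ℝ) → ℝ := fun y => ∑ i, gaussianLLR v (u i) (y i) with hL
  have hLi : ∀ i ∈ Finset.univ, Integrable (fun y : ι → ℝ => gaussianLLR v (u i) (y i)) P :=
    fun i _ => integrable_comp_eval (integrable_gaussianLLR (u i) v)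
  have hLint : Integrable L P := integrable_finsetSum _ hLi
  have hLval : ∫ y, L y ∂P = (∑ i, u i ^ 2) / (2 * v) := by
    rw [hL, integral_finsetSum _ hLi, Finset.sum_div]
    refine Finset.sum_congr rfl fun i _ => ?_
    rw [hP, integral_comp_eval (μ := fun i => gaussianReal (u i) v)
      (f := fun y => gaussianLLR v (u i) y) (measurable_gaussianLLR v (u i)).aestronglyMeasurable,
      integral_gaussianLLR _ hv]
  have hE : Integrable (fun y => Real.exp (-L y)) P := integrable_exp_neg_sum_gaussianLLR u v
  have hQP : Q = P.withDensity fun y => ENNReal.ofReal (Real.exp (-L y)) :=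
    pi_gaussianReal_zero_eq_withDensity u hv
  have hset : ∀ B, MeasurableSet B → ∫ y in B, Real.exp (-L y) ∂P = Q.real B := by
    intro B hB
    rw [Measure.real, hQP, withDensity_apply _ hB,
      ← ofReal_integral_eq_lintegral_ofReal hE.restrict (ae_of_all _ fun y => (Real.exp_pos _).le),
      ENNReal.toReal_ofReal (integral_nonneg fun y => (Real.exp_pos _).le)]
  have h1 : Integrable (A.indicator fun _ => c) P := (integrable_const c).indicator hA
  have h2 : Integrable (A.indicator fun y => (Real.exp c - 1) * Real.exp (-L y)) P :=
    (hE.const_mul _).indicator hA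
  -- Integrate `1 + x ≤ exp x` at `x = c 1_A - L`. Since `exp (-L)` is the density of `Q` with
  -- respect to `P`, the right side integrates to `(exp c - 1) Q(A) + 1 - 1`.
  have key : ∫ y, (A.indicator (fun _ => c) y - L y) ∂P ≤
      ∫ y, (A.indicator (fun y => (Real.exp c - 1) * Real.exp (-L y)) y + Real.exp (-L y) - 1)
        ∂P := by
    refine integral_mono (h1.sub hLint) ((h2.add hE).sub (integrable_const _)) fun y => ?_
    by_cases hy : y ∈ A
    · simp only [Set.indicator_of_mem hy]
      have := Real.add_one_le_exp (c - L y)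
      rw [sub_eq_add_neg c, Real.exp_add] at this
      linarith
    · simp only [Set.indicator_of_notMem hy]
      have := Real.add_one_le_exp (-L y)
      linarith
  have hr : ∫ y, (A.indicator (fun y => (Real.exp c - 1) * Real.exp (-L y)) y + Real.exp (-L y) - 1)
      ∂P = ∫ y, A.indicator (fun y => (Real.exp c - 1) * Real.exp (-L y)) y ∂P +
        ∫ y, Real.exp (-L y) ∂P - ∫ _, (1 : ℝ) ∂P := by
    rw [← integral_add h2 hE]
    exact integral_sub (h2.add hE) (integrable_const _)
  rw [integral_sub h1 hLint, hr, integral_indicator hA, integral_indicator hA, integral_const_mul,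
    hset A hA, hLval] at key
  have huniv := hset Set.univ MeasurableSet.univ
  rw [setIntegral_univ] at huniv
  rw [huniv] at key
  simp at key
  linarith

end

/-! ### The sampling times -/

/-- The number of output symbols caused by the input symbols with index below `k`. -/
def prefixLength {T : ℕ} (s : Fin T → ℕ) (k : ℕ) : ℕ := ∑ t with t.val < k, s t

theorem prefixLength_mono {T : ℕ} (s : Fin T → ℕ) : Monotone (prefixLength s) := by
  intro j k hjk
  refine Finset.sum_le_sum_of_subset fun t ht => ?_
  simp only [Finset.mem_filter, Finset.mem_univ, true_and] at ht ⊢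
  omega

theorem prefixLength_eq_outputLength {T : ℕ} (s : Fin T → ℕ) : prefixLength s T = outputLength s := by
  simp [prefixLength, outputLength]

theorem prefixLength_le_outputLength {T : ℕ} (s : Fin T → ℕ) (k : ℕ) :
    prefixLength s k ≤ outputLength s :=
  Finset.sum_le_sum_of_subset (Finset.filter_subset _ _)

theorem prefixLength_succ {T : ℕ} (s : Fin T → ℕ) (t : Fin T) :
    prefixLength s (t + 1) = prefixLength s t + s t := by
  have h : (Finset.univ.filter fun j : Fin T => j.val < t + 1) =
      insert t (Finset.univ.filter fun j : Fin T => j.val < t) := by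
    ext j
    simp only [Finset.mem_filter, Finset.mem_univ, true_and, Finset.mem_insert, Fin.ext_iff]
    omega
  rw [prefixLength, h, Finset.sum_insert (by simp), prefixLength, add_comm]

/-- The sampling time is the generalized inverse of the prefix lengths. Statements about which input
symbol caused an output position thus become interval conditions on that position. -/
theorem sampleTime_lt_iff {T : ℕ} (s : Fin T → ℕ) (l : Fin (outputLength s)) (k : ℕ) :
    (sampleTime s l).val < k ↔ l.val < prefixLength s k := by
  have hIic : ∀ t : Fin T, ∑ j ∈ Finset.Iic t, s j = prefixLength s (t + 1) := by
    intro t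
    refine Finset.sum_congr ?_ fun _ _ => rfl
    ext j
    simp only [Finset.mem_Iic, Finset.mem_filter, Finset.mem_univ, true_and, Fin.le_def]
    omega
  have hmem := Finset.min'_mem _ (sampleTime_nonempty s l)
  change sampleTime s l ∈ _ at hmem
  simp only [Finset.mem_filter, Finset.mem_univ, true_and, hIic] at hmem
  constructor
  · intro h
    exact hmem.trans_le (prefixLength_mono s h)
  · intro h
    rcases k with _ | k
    · simp [prefixLength] at h
    by_cases hk : k < T
    · have : sampleTime s l ≤ ⟨k, hk⟩ := by
        refine Finset.min'_le _ _ ?_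
        simp only [Finset.mem_filter, Finset.mem_univ, true_and, hIic]
        exact h
      have := Fin.le_def.1 this
      simp only at this
      omega
    · have := (sampleTime s l).isLt
      omega

theorem card_fin_filter_between (n a b : ℕ) (hb : b ≤ n) :
    (Finset.univ.filter fun l : Fin n => a ≤ l.val ∧ l.val < b).card = b - a := by
  rw [← Nat.card_Ico, ← Finset.card_map Fin.valEmbedding]
  congr 1
  ext i
  simp only [Finset.mem_map, Finset.mem_filter, Finset.mem_univ, true_and, Fin.valEmbedding_apply,
    Finset.mem_Ico]
  constructor
  · rintro ⟨l, h, rfl⟩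
    exact h
  · intro h
    exact ⟨⟨i, by omega⟩, h, rfl⟩

theorem card_sampleTime_eq {T : ℕ} (s : Fin T → ℕ) (t : Fin T) :
    (Finset.univ.filter fun l => sampleTime s l = t).card = s t := by
  have h : (Finset.univ.filter fun l => sampleTime s l = t) =
      Finset.univ.filter fun l : Fin (outputLength s) =>
        prefixLength s t ≤ l.val ∧ l.val < prefixLength s (t + 1) := by
    ext l
    simp only [Finset.mem_filter, Finset.mem_univ, true_and]
    rw [← sampleTime_lt_iff, ← not_lt, ← sampleTime_lt_iff, Fin.ext_iff]
    omega
  rw [h, card_fin_filter_between _ _ _ (prefixLength_le_outputLength s _), prefixLength_succ]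
  omega

/-- Each input symbol occupies exactly `s t` output positions. This makes the relative entropy
linear in the states, so only their mean enters the converse. -/
theorem sum_idcOutput_sq {T : ℕ} (x : Fin T → ℝ) (s : Fin T → ℕ) :
    ∑ l, idcOutput x s l ^ 2 = ∑ t, (s t : ℝ) * x t ^ 2 := by
  unfold idcOutput
  rw [← Finset.sum_fiberwise (s := Finset.univ) (g := sampleTime s)]
  refine Finset.sum_congr rfl fun t _ => ?_
  rw [Finset.sum_congr rfl (g := fun _ => x t ^ 2), Finset.sum_const, card_sampleTime_eq,
    nsmul_eq_mul]
  intro l hl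
  rw [(Finset.mem_filter.1 hl).2]

/-! ### The converse -/

instance {T : ℕ} (η : ℝ≥0) (x : Fin T → ℝ) (s : Fin T → ℕ) :
    IsProbabilityMeasure (noisyOutput η x s) := by
  unfold noisyOutput; infer_instance

instance (ν : ProbabilityMeasure ℕ) (T : ℕ) : IsProbabilityMeasure (stateLaw ν T) := by
  unfold stateLaw; infer_instance

theorem Code.measurableSet_decoder_eq {T M : ℕ} (C : Code T M) (n : ℕ) (m : Fin M) :
    MeasurableSet {y : Fin n → ℝ | C.decoder n y = m} :=
  C.measurable_decoder n (measurableSet_singleton m)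

/-- The conditional probability of correct decoding given the state sequence. -/
def Code.successProb {T M : ℕ} (C : Code T M) (η : ℝ≥0) (m : Fin M) (s : Fin T → ℕ) : ℝ :=
  (noisyOutput η (C.codeword m) s).real {y | C.decoder (outputLength s) y = m}

/-- The reference law `Q` depends on the states but not on the message, so the terms `Q(decode to
m)` add up to one. -/
theorem Code.sum_successProb_le {T M : ℕ} (C : Code T M) {η : ℝ≥0} (hη : η ≠ 0) (c : ℝ)
    (s : Fin T → ℕ) :
    c * ∑ m, C.successProb η m s ≤
      (∑ m, ∑ t, (s t : ℝ) * C.codeword m t ^ 2) / (2 * (η : ℝ) ^ 2) + Real.exp c := by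
  set Q := Measure.pi fun _ : Fin (outputLength s) => gaussianReal 0 (η ^ 2)
  have hQ : ∑ m, Q.real {y | C.decoder (outputLength s) y = m} = 1 := by
    rw [← measureReal_iUnion_fintype]
    · have : (⋃ m, {y | C.decoder (outputLength s) y = m}) = Set.univ := by
        ext y; simp
      rw [this, probReal_univ]
    · intro m m' hmm
      refine Set.disjoint_left.2 fun y hy hy' => hmm ?_
      exact hy.symm.trans hy'
    · exact fun m => C.measurableSet_decoder_eq _ m
  have hm : ∀ m, c * C.successProb η m s ≤
      (∑ t, (s t : ℝ) * C.codeword m t ^ 2) / (2 * (η : ℝ) ^ 2) +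
        (Real.exp c - 1) * Q.real {y | C.decoder (outputLength s) y = m} := by
    intro m
    have := mul_pi_gaussianReal_le (idcOutput (C.codeword m) s) (v := η ^ 2) (pow_ne_zero 2 hη)
      (C.measurableSet_decoder_eq (outputLength s) m) c
    rw [sum_idcOutput_sq] at this
    push_cast at this
    exact this
  have h := Finset.sum_le_sum fun m (_ : m ∈ Finset.univ) => hm m
  rw [← Finset.mul_sum, Finset.sum_add_distrib, ← Finset.mul_sum, hQ, ← Finset.sum_div] at h
  linarith

theorem Code.integrable_successProb {T M : ℕ} (C : Code T M) (ν : ProbabilityMeasure ℕ) (η : ℝ≥0)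
    (m : Fin M) : Integrable (C.successProb η m) (stateLaw ν T) :=
  Integrable.of_bound (measurable_of_countable _).aestronglyMeasurable 1 <|
    ae_of_all _ fun s => by
      rw [Code.successProb, Real.norm_of_nonneg measureReal_nonneg]
      exact measureReal_le_one

theorem Code.errorProb_toReal {T M : ℕ} (C : Code T M) (ν : ProbabilityMeasure ℕ) (η : ℝ≥0)
    (m : Fin M) :
    (C.errorProb ν η m).toReal = 1 - ∫ s, C.successProb η m s ∂stateLaw ν T := by
  have h : ∀ s : Fin T → ℕ, noisyOutput η (C.codeword m) s {y | C.decoder (outputLength s) y ≠ m} =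
      ENNReal.ofReal (1 - C.successProb η m s) := by
    intro s
    rw [Code.successProb, ← probReal_compl_eq_one_sub (C.measurableSet_decoder_eq _ m),
      ofReal_measureReal]
    rfl
  unfold Code.errorProb
  simp only [h]
  have hi : Integrable (fun s => 1 - C.successProb η m s) (stateLaw ν T) :=
    (integrable_const _).sub (C.integrable_successProb ν η m)
  have h0 : ∀ s, 0 ≤ 1 - C.successProb η m s := fun s => sub_nonneg.2 measureReal_le_one
  rw [← ofReal_integral_eq_lintegral_ofReal hi (ae_of_all _ h0),
    ENNReal.toReal_ofReal (integral_nonneg h0),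
    integral_sub (integrable_const _) (C.integrable_successProb ν η m)]
  simp

theorem Code.errorProb_le_one {T M : ℕ} (C : Code T M) (ν : ProbabilityMeasure ℕ) (η : ℝ≥0)
    (m : Fin M) : C.errorProb ν η m ≤ 1 := by
  unfold Code.errorProb
  calc _ ≤ ∫⁻ _, 1 ∂stateLaw ν T := lintegral_mono fun s => prob_le_one
    _ = 1 := by simp

theorem integrable_state {ν : ProbabilityMeasure ℕ}
    (hν : MemLp (fun k : ℕ => (k : ℝ)) 2 (ν : Measure ℕ)) {T : ℕ} (t : Fin T) :
    Integrable (fun s : Fin T → ℕ => (s t : ℝ)) (stateLaw ν T) :=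
  integrable_comp_eval (μ := fun _ : Fin T => (ν : Measure ℕ)) (f := fun k : ℕ => (k : ℝ))
    (hν.integrable one_le_two)

theorem integral_state (ν : ProbabilityMeasure ℕ) {T : ℕ} (t : Fin T) :
    ∫ s, (s t : ℝ) ∂stateLaw ν T = ∫ k, (k : ℝ) ∂(ν : Measure ℕ) :=
  integral_comp_eval (μ := fun _ : Fin T => (ν : Measure ℕ)) (f := fun k : ℕ => (k : ℝ))
    (measurable_of_countable _).aestronglyMeasurable

/-- Fano-type bound on the number of messages of a good code. -/
theorem Code.IsGood.log_card_le {T M : ℕ} {C : Code T M} {ν : ProbabilityMeasure ℕ} {η : ℝ≥0}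
    {P ε : ℝ} (hC : C.IsGood {ν} η P ε) (hη : η ≠ 0) (hM : 0 < M) (hε : 0 ≤ ε)
    (hν : MemLp (fun k : ℕ => (k : ℝ)) 2 (ν : Measure ℕ)) :
    (1 - ε) * Real.log M ≤
      (∫ k, (k : ℝ) ∂(ν : Measure ℕ)) * P / (2 * (η : ℝ) ^ 2) + 1 := by
  set μ := ∫ k, (k : ℝ) ∂(ν : Measure ℕ) with hμ
  have hMR : (0 : ℝ) < M := by exact_mod_cast hM
  have hη2 : (0 : ℝ) < 2 * (η : ℝ) ^ 2 := by
    have : (0 : ℝ) < η := by exact_mod_cast pos_iff_ne_zero.2 hη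
    positivity
  have hμ0 : 0 ≤ μ := integral_nonneg fun k => Nat.cast_nonneg k
  have hc : 0 ≤ Real.log M := Real.log_natCast_nonneg M
  -- With `c = log M` the term `exp c` equals `M`, which contributes only `1` after division by the
  -- number of messages.
  have hpt := fun s => C.sum_successProb_le hη (Real.log M) s
  have hSi : Integrable (fun s => ∑ m, C.successProb η m s) (stateLaw ν T) :=
    integrable_finsetSum _ fun m _ => C.integrable_successProb ν η m
  have hEi : ∀ m ∈ (Finset.univ : Finset (Fin M)), Integrable
      (fun s : Fin T → ℕ => ∑ t, (s t : ℝ) * C.codeword m t ^ 2) (stateLaw ν T) :=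
    fun m _ => integrable_finsetSum _ fun t _ => (integrable_state hν t).mul_const _
  have hint := integral_mono (hSi.const_mul (Real.log M))
    (((integrable_finsetSum _ hEi).div_const (2 * (η : ℝ) ^ 2)).add
      (integrable_const (Real.exp (Real.log M)))) hpt
  have hEval : ∀ m, ∫ s, ∑ t, (s t : ℝ) * C.codeword m t ^ 2 ∂stateLaw ν T =
      μ * energy (C.codeword m) := by
    intro m
    rw [integral_finsetSum _ fun t _ => (integrable_state hν t).mul_const _, energy,
      Finset.mul_sum]
    refine Finset.sum_congr rfl fun t _ => ?_
    rw [integral_mul_const, integral_state]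
  have hr : ∫ s, ((∑ m, ∑ t, (s t : ℝ) * C.codeword m t ^ 2) / (2 * (η : ℝ) ^ 2) +
      Real.exp (Real.log M)) ∂stateLaw ν T ≤ M * (μ * P) / (2 * (η : ℝ) ^ 2) + M := by
    rw [integral_add ((integrable_finsetSum _ hEi).div_const _) (integrable_const _),
      integral_div, integral_finsetSum _ hEi, Real.exp_log hMR]
    simp only [integral_const, probReal_univ, one_smul]
    gcongr
    calc ∑ m, ∫ s, ∑ t, (s t : ℝ) * C.codeword m t ^ 2 ∂stateLaw ν T
        ≤ ∑ _m : Fin M, μ * P := by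
          refine Finset.sum_le_sum fun m _ => ?_
          rw [hEval]
          exact mul_le_mul_of_nonneg_left (hC.1 m) hμ0
      _ = M * (μ * P) := by simp
  have herr : M * (1 - ε) ≤ ∫ s, ∑ m, C.successProb η m s ∂stateLaw ν T := by
    rw [integral_finsetSum _ fun m _ => C.integrable_successProb ν η m]
    have h := hC.2 ν rfl
    unfold Code.avgErrorProb at h
    have h' := ENNReal.toReal_mono ENNReal.ofReal_ne_top h
    rw [ENNReal.toReal_ofReal hε, ENNReal.toReal_div, ENNReal.toReal_natCast, div_le_iff₀ hMR,
      ENNReal.toReal_sum fun m _ => ne_top_of_le_ne_top ENNReal.one_ne_top (C.errorProb_le_one ν η m)]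
      at h'
    simp only [Code.errorProb_toReal, Finset.sum_sub_distrib] at h'
    simp at h'
    linarith
  have hfin : Real.log M * (M * (1 - ε)) ≤ M * (μ * P) / (2 * (η : ℝ) ^ 2) + M := by
    refine (mul_le_mul_of_nonneg_left herr hc).trans ?_
    rw [← integral_const_mul]
    exact hint.trans hr
  have : M * ((1 - ε) * Real.log M) ≤ M * (μ * P / (2 * (η : ℝ) ^ 2) + 1) := by
    calc _ = Real.log M * (M * (1 - ε)) := by ring
      _ ≤ _ := hfin
      _ = _ := by ring
  exact le_of_mul_le_mul_left this hMR

theorem Achievable.le_of_memLp {ν : ProbabilityMeasure ℕ} {η : ℝ≥0} {R : ℝ}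
    (hR : Achievable {ν} η R) (hη : η ≠ 0)
    (hν : MemLp (fun k : ℕ => (k : ℝ)) 2 (ν : Measure ℕ)) :
    R ≤ (∫ k, (k : ℝ) ∂(ν : Measure ℕ)) / (2 * (η : ℝ) ^ 2 * Real.log 2) := by
  set μ := ∫ k, (k : ℝ) ∂(ν : Measure ℕ) with hμ
  have hμ0 : 0 ≤ μ := integral_nonneg fun k => Nat.cast_nonneg k
  have hη2 : (0 : ℝ) < 2 * (η : ℝ) ^ 2 := by
    have : (0 : ℝ) < η := by exact_mod_cast pos_iff_ne_zero.2 hη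
    positivity
  have hl2 : 0 < Real.log 2 := Real.log_pos one_lt_two
  set c := μ / (2 * (η : ℝ) ^ 2 * Real.log 2) with hcdef
  have hc0 : 0 ≤ c := by positivity
  by_contra! hlt
  have hR0 : 0 < R := hc0.trans_lt hlt
  have hr : c / R < 1 := (div_lt_one hR0).2 hlt
  -- With this choice `1 - ε - c / R = ε`, so the Fano-type bound reads `ε * log M ≤ 1`, which fails
  -- once `M > exp (1 / ε)`.
  set ε := (1 - c / R) / 2 with hε
  have hε0 : 0 < ε := by linarith
  obtain ⟨M₀, hM₀⟩ := hR ε hε0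
  obtain ⟨N, hN⟩ := exists_nat_gt (Real.exp (1 / ε))
  set M := max N (max M₀ 1) with hM
  obtain ⟨T, P, C, hP, hgood, hrate⟩ := hM₀ M ((le_max_left _ _).trans (le_max_right _ _))
  have hMpos : 0 < M := lt_of_lt_of_le one_pos ((le_max_right _ _).trans (le_max_right _ _))
  have hfano := hgood.log_card_le hη hMpos hε0.le hν
  have hlog : 1 / ε < Real.log M := by
    rw [Real.lt_log_iff_exp_lt (by exact_mod_cast hMpos)]
    exact hN.trans_le (by exact_mod_cast le_max_left _ _)
  have hbound : μ * P / (2 * (η : ℝ) ^ 2) ≤ c / R * Real.log M := by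
    rw [le_div_iff₀ hP, Real.logb, le_div_iff₀ hl2] at hrate
    calc μ * P / (2 * (η : ℝ) ^ 2) = c / R * (R * P * Real.log 2) := by
          rw [hcdef]; field_simp
      _ ≤ _ := mul_le_mul_of_nonneg_left hrate (by positivity)
  have h1 : ε * Real.log M ≤ 1 := by
    have : (1 - ε) * Real.log M - c / R * Real.log M = ε * Real.log M := by
      rw [hε]; ring
    linarith
  rw [div_lt_iff₀ hε0] at hlog
  linarith

/-! ### Gaussian tails -/

/-- The sub-Gaussian parameter is the exact variance. Any loss here would spoil the constant in the
capacity. -/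
theorem hasSubgaussianMGF_sub_mean (u : ℝ) (v : ℝ≥0) :
    HasSubgaussianMGF (fun y => y - u) v (gaussianReal u v) := by
  have hmap : (gaussianReal u v).map (fun y => y - u) = gaussianReal 0 v := by
    rw [gaussianReal_map_sub_const, sub_self]
  constructor
  · intro t
    have h := (integrable_exp_mul_gaussianReal (μ := u) (v := v) t).mul_const (Real.exp (-(t * u)))
    refine h.congr (ae_of_all _ fun y => ?_)
    simp only
    rw [← Real.exp_add]
    congr 1
    ring
  · intro t
    rw [mgf_gaussianReal hmap]
    simp

section

variable {ι : Type*} [Fintype ι]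

theorem hasSubgaussianMGF_sub_eval (u : ι → ℝ) (v : ℝ≥0) (i : ι) :
    HasSubgaussianMGF (fun y : ι → ℝ => y i - u i) v (Measure.pi fun i => gaussianReal (u i) v) :=
  HasSubgaussianMGF.of_map (X := fun y => y - u i) (Y := fun y : ι → ℝ => y i)
    (measurable_pi_apply i).aemeasurable <| by
      rw [(measurePreserving_eval (fun i => gaussianReal (u i) v) i).map_eq]
      exact hasSubgaussianMGF_sub_mean (u i) v

theorem hasSubgaussianMGF_sum_sub (u : ι → ℝ) (v : ℝ≥0) (B : Finset ι) :
    HasSubgaussianMGF (fun y : ι → ℝ => ∑ i ∈ B, (y i - u i)) (B.card * v)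
      (Measure.pi fun i => gaussianReal (u i) v) := by
  have h := HasSubgaussianMGF.sum_of_iIndepFun (μ := Measure.pi fun i => gaussianReal (u i) v)
    (X := fun i (y : ι → ℝ) => y i - u i) (c := fun _ => v) (s := B)
    (iIndepFun_pi (X := fun i y => y - u i) fun i => by fun_prop)
    fun i _ => hasSubgaussianMGF_sub_eval u v i
  simpa using h

theorem exp_neg_sq_div_le {r w v b : ℝ} (hv : 0 < v) (hb : 0 < b) (hbw : b ≤ w) :
    Real.exp (-r ^ 2 / (2 * (b * v))) ≤ Real.exp (-(r ^ 2 / (2 * (w * v)))) := by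
  rw [neg_div]
  gcongr

theorem measureReal_le_sum_le (u : ι → ℝ) {v : ℝ≥0} (hv : 0 < v) (B : Finset ι) {r w τ : ℝ}
    (hr : 0 < r) (hw : (B.card : ℝ) ≤ w) (hτ : ∑ i ∈ B, u i + r ≤ τ) :
    (Measure.pi fun i => gaussianReal (u i) v).real {y | τ ≤ ∑ i ∈ B, y i} ≤
      Real.exp (-(r ^ 2 / (2 * (w * v)))) := by
  -- For empty `B` the variance proxy is zero and the tail bound, with its division by zero, is
  -- useless; the event itself is empty because `r > 0`.
  rcases B.eq_empty_or_nonempty with rfl | hB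
  · have : {y : ι → ℝ | τ ≤ ∑ i ∈ (∅ : Finset ι), y i} = ∅ := by
      ext y
      simp only [Finset.sum_empty, zero_add] at hτ ⊢
      simp only [Set.mem_ofPred_eq, Set.mem_empty_iff_false, iff_false, not_le]
      linarith
    rw [this, measureReal_empty]
    positivity
  have h := (hasSubgaussianMGF_sum_sub u v B).measure_ge_le hr.le
  refine (measureReal_mono fun y hy => ?_).trans (h.trans ?_)
  · simp only [Set.mem_ofPred_eq, Finset.sum_sub_distrib] at hy ⊢
    linarith
  · push_cast
    exact exp_neg_sq_div_le (by exact_mod_cast hv) (by exact_mod_cast hB.card_pos) hw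

theorem measureReal_sum_lt_le (u : ι → ℝ) {v : ℝ≥0} (hv : 0 < v) (B : Finset ι) {r w τ : ℝ}
    (hr : 0 < r) (hw : (B.card : ℝ) ≤ w) (hτ : τ ≤ ∑ i ∈ B, u i - r) :
    (Measure.pi fun i => gaussianReal (u i) v).real {y | ∑ i ∈ B, y i < τ} ≤
      Real.exp (-(r ^ 2 / (2 * (w * v)))) := by
  rcases B.eq_empty_or_nonempty with rfl | hB
  · have : {y : ι → ℝ | ∑ i ∈ (∅ : Finset ι), y i < τ} = ∅ := by
      ext y
      simp only [Finset.sum_empty, zero_sub] at hτ ⊢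
      simp only [Set.mem_ofPred_eq, Set.mem_empty_iff_false, iff_false, not_lt]
      linarith
    rw [this, measureReal_empty]
    positivity
  have h := (hasSubgaussianMGF_sum_sub u v B).neg.measure_ge_le hr.le
  refine (measureReal_mono fun y hy => ?_).trans (h.trans ?_)
  · simp only [Set.mem_ofPred_eq, Finset.sum_sub_distrib, Pi.neg_apply] at hy ⊢
    linarith
  · push_cast
    exact exp_neg_sq_div_le (by exact_mod_cast hv) (by exact_mod_cast hB.card_pos) hw

end

/-! ### Concentration of the state sequence -/

theorem card_fin_val_lt {n k : ℕ} (hk : k ≤ n) :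
    (Finset.univ.filter fun t : Fin n => t.val < k).card = k := by
  simpa using card_fin_filter_between n 0 k hk

/-- This is Chebyshev's inequality for a sum of independent states; only second moments are
available. -/
theorem measure_le_abs_prefixLength_sub_le {ν : ProbabilityMeasure ℕ}
    (hν : MemLp (fun k : ℕ => (k : ℝ)) 2 (ν : Measure ℕ)) {T k : ℕ} (hk : k ≤ T) {c : ℝ}
    (hc : 0 < c) :
    stateLaw ν T {s | c ≤ |(prefixLength s k : ℝ) - k * ∫ k, (k : ℝ) ∂(ν : Measure ℕ)|} ≤
      ENNReal.ofReal (k * variance (fun k : ℕ => (k : ℝ)) (ν : Measure ℕ) / c ^ 2) := by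
  set F := Finset.univ.filter fun t : Fin T => t.val < k with hF
  have hmp : ∀ t : Fin T, MeasurePreserving (fun s : Fin T → ℕ => s t) (stateLaw ν T)
      (ν : Measure ℕ) := fun t => measurePreserving_eval (fun _ : Fin T => (ν : Measure ℕ)) t
  have hX : ∀ t ∈ F, MemLp (fun s : Fin T → ℕ => (s t : ℝ)) 2 (stateLaw ν T) :=
    fun t _ => hν.comp_measurePreserving (hmp t)
  have hS : MemLp (∑ t ∈ F, fun s : Fin T → ℕ => (s t : ℝ)) 2 (stateLaw ν T) :=
    memLp_finsetSum' _ hX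
  have happ : ∀ s : Fin T → ℕ, (∑ t ∈ F, fun s : Fin T → ℕ => (s t : ℝ)) s = prefixLength s k := by
    intro s
    rw [Finset.sum_apply, prefixLength]
    push_cast
    rfl
  have hmean : ∫ s, (∑ t ∈ F, fun s : Fin T → ℕ => (s t : ℝ)) s ∂stateLaw ν T =
      k * ∫ k, (k : ℝ) ∂(ν : Measure ℕ) := by
    simp only [Finset.sum_apply]
    rw [integral_finsetSum _ fun t _ => integrable_state hν t]
    simp only [integral_state, Finset.sum_const, hF, card_fin_val_lt hk, nsmul_eq_mul]
  have hvar : variance (∑ t ∈ F, fun s : Fin T → ℕ => (s t : ℝ)) (stateLaw ν T) =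
      k * variance (fun k : ℕ => (k : ℝ)) (ν : Measure ℕ) := by
    rw [IndepFun.variance_sum hX]
    · have : ∀ t ∈ F, variance (fun s : Fin T → ℕ => (s t : ℝ)) (stateLaw ν T) =
          variance (fun k : ℕ => (k : ℝ)) (ν : Measure ℕ) := by
        intro t _
        rw [← (hmp t).map_eq, variance_map (measurable_of_countable _).aemeasurable
          (hmp t).measurable.aemeasurable]
        rfl
      rw [Finset.sum_congr rfl this, Finset.sum_const, hF, card_fin_val_lt hk, nsmul_eq_mul]
    · intro i _ j _ hij
      exact (iIndepFun_pi (μ := fun _ : Fin T => (ν : Measure ℕ)) (X := fun _ (k : ℕ) => (k : ℝ))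
        fun _ => (measurable_of_countable _).aemeasurable).indepFun hij
  have h := meas_ge_le_variance_div_sq hS hc
  rw [hmean, hvar] at h
  simpa only [happ] using h

/-! ### Pulse position codes -/

/-- The output positions in the `j`-th of `M` windows of equal length. -/
def window (M n j : ℕ) : Finset (Fin n) :=
  Finset.univ.filter fun l => j * (n / M : ℝ) ≤ l ∧ (l : ℝ) < (j + 1) * (n / M : ℝ)

theorem card_fin_filter_le {n : ℕ} {a b w : ℝ} (hw : 0 ≤ w) (h : b - a ≤ w) :
    ((Finset.univ.filter fun l : Fin n => a ≤ l ∧ (l : ℝ) < b).card : ℝ) ≤ w + 1 := by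
  by_cases hab : a < b ∧ 0 < b
  · have hsub : (Finset.univ.filter fun l : Fin n => a ≤ l ∧ (l : ℝ) < b).map Fin.valEmbedding ⊆
        Finset.Ico ⌈a⌉₊ ⌈b⌉₊ := by
      intro i hi
      simp only [Finset.mem_map, Finset.mem_filter, Finset.mem_univ, true_and,
        Fin.valEmbedding_apply] at hi
      obtain ⟨l, ⟨h1, h2⟩, rfl⟩ := hi
      exact Finset.mem_Ico.2 ⟨Nat.ceil_le.2 h1, Nat.lt_ceil.2 h2⟩
    have hc := Finset.card_le_card hsub
    rw [Finset.card_map, Nat.card_Ico] at hc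
    have hle : ⌈a⌉₊ ≤ ⌈b⌉₊ := Nat.ceil_mono hab.1.le
    have hc' : ((Finset.univ.filter fun l : Fin n => a ≤ l ∧ (l : ℝ) < b).card : ℝ) ≤
        (⌈b⌉₊ : ℝ) - ⌈a⌉₊ := by
      rw [← Nat.cast_sub hle]
      exact_mod_cast hc
    have h1 := Nat.ceil_lt_add_one hab.2.le
    have h2 := Nat.le_ceil a
    linarith
  · rw [Finset.filter_eq_empty_iff.2]
    · simp
      linarith
    · rintro l _ ⟨h1, h2⟩
      exact hab ⟨h1.trans_lt h2, (Nat.cast_nonneg _).trans_lt h2⟩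

theorem le_card_fin_filter {n : ℕ} {a b : ℝ} (ha : 0 ≤ a) (hb : b ≤ n) :
    b - a - 1 ≤ (Finset.univ.filter fun l : Fin n => a ≤ l ∧ (l : ℝ) < b).card := by
  have hsub : (Finset.univ.filter fun l : Fin n => ⌈a⌉₊ ≤ l.val ∧ l.val < ⌈b⌉₊) ⊆
      (Finset.univ.filter fun l : Fin n => a ≤ l ∧ (l : ℝ) < b) := by
    intro l hl
    simp only [Finset.mem_filter, Finset.mem_univ, true_and] at hl ⊢
    exact ⟨Nat.ceil_le.1 hl.1, Nat.lt_ceil.1 hl.2⟩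
  have hc := Finset.card_le_card hsub
  rw [card_fin_filter_between _ _ _ (Nat.ceil_le.2 hb), tsub_le_iff_right] at hc
  have hc' : (⌈b⌉₊ : ℝ) ≤
      (Finset.univ.filter fun l : Fin n => a ≤ l ∧ (l : ℝ) < b).card + (⌈a⌉₊ : ℝ) := by
    exact_mod_cast hc
  have h1 := Nat.ceil_lt_add_one ha
  have h2 := Nat.le_ceil b
  linarith

open Classical in
/-- An index that satisfies a predicate, provided there is one. -/
def pick {M : ℕ} (hM : 0 < M) (p : Fin M → Prop) : Fin M :=
  if h : ∃ m, p m then h.choose else ⟨0, hM⟩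

theorem pick_eq {M : ℕ} (hM : 0 < M) {p : Fin M → Prop} {m : Fin M} (hm : p m)
    (hu : ∀ j, j ≠ m → ¬p j) : pick hM p = m := by
  have h : ∃ m, p m := ⟨m, hm⟩
  rw [pick, dif_pos h]
  by_contra hne
  exact hu _ hne h.choose_spec

/-- Message `m` is sent as a rectangular pulse of height `a` on the `m`-th of `M` blocks of `K`
symbols. The decoder cuts the received sequence into `M` windows of equal length and looks for one
in which the sum of the samples is close to that of a pulse filling it. -/
def pulseCode (M K : ℕ) (hM : 0 < M) (a δ : ℝ) : Code (M * K) M where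
  codeword m t := if m * K ≤ t.val ∧ t.val < (m + 1) * K then a else 0
  decoder n y := pick hM fun j => (1 - 2 * δ) * (a * (n / M : ℝ)) ≤ ∑ l ∈ window M n j, y l
  measurable_decoder n := by
    -- `pick` acts on the countable space of truth tables `Fin M → Prop`, so only the individual
    -- threshold tests need to be measurable.
    refine (measurable_of_countable (pick hM)).comp (measurable_pi_lambda _ fun j => ?_)
    refine measurable_to_prop ?_
    have : (fun y : Fin n → ℝ => (1 - 2 * δ) * (a * (n / M : ℝ)) ≤ ∑ l ∈ window M n j, y l) ⁻¹'
        {True} = {y | (1 - 2 * δ) * (a * (n / M : ℝ)) ≤ ∑ l ∈ window M n j, y l} := by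
      ext y; simp
    rw [this]
    exact measurableSet_le measurable_const
      (Finset.measurable_fun_sum _ fun l _ => measurable_pi_apply l)

theorem energy_pulseCode {M K : ℕ} (hM : 0 < M) (a δ : ℝ) (m : Fin M) :
    energy ((pulseCode M K hM a δ).codeword m) = K * a ^ 2 := by
  have hle : ((m : ℕ) + 1) * K ≤ M * K := Nat.mul_le_mul_right _ m.isLt
  simp only [energy, pulseCode, ite_pow]
  rw [← Finset.sum_filter_add_sum_filter_not Finset.univ
    (fun t : Fin (M * K) => m * K ≤ t.val ∧ t.val < (m + 1) * K)]
  rw [Finset.sum_congr rfl (g := fun _ => a ^ 2), Finset.sum_const,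
    card_fin_filter_between _ _ _ hle, Finset.sum_eq_zero]
  · rw [add_zero, nsmul_eq_mul, add_mul, one_mul, Nat.add_sub_cancel_left]
  · intro t ht
    rw [if_neg (Finset.mem_filter.1 ht).2]
    norm_num
  · intro t ht
    rw [if_pos (Finset.mem_filter.1 ht).2]

theorem idcOutput_pulseCode {M K : ℕ} (hM : 0 < M) (a δ : ℝ) (m : Fin M) (s : Fin (M * K) → ℕ)
    (l : Fin (outputLength s)) :
    idcOutput ((pulseCode M K hM a δ).codeword m) s l =
      if prefixLength s (m * K) ≤ l.val ∧ l.val < prefixLength s ((m + 1) * K) then a else 0 := by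
  simp only [idcOutput, pulseCode]
  simp only [← sampleTime_lt_iff, ← not_lt (b := prefixLength s (m * K)), not_lt]

theorem sum_window_idcOutput {M K : ℕ} (hM : 0 < M) (a δ : ℝ) (m j : Fin M)
    (s : Fin (M * K) → ℕ) :
    ∑ l ∈ window M (outputLength s) j, idcOutput ((pulseCode M K hM a δ).codeword m) s l =
      a * ((window M (outputLength s) j).filter fun l => prefixLength s (m * K) ≤ l.val ∧
        l.val < prefixLength s ((m + 1) * K)).card := by
  simp only [idcOutput_pulseCode]
  rw [← Finset.sum_filter, Finset.sum_const, nsmul_eq_mul, mul_comm]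

/-- The state sequence `s` spreads the `M` blocks of `K` symbols evenly over the output, up to a
displacement of at most `D` positions. -/
def EvenlySpread (M K : ℕ) (D : ℝ) (s : Fin (M * K) → ℕ) : Prop :=
  ∀ j ≤ M, |(prefixLength s (j * K) : ℝ) - j * (outputLength s / M : ℝ)| ≤ D

/-- Window `m` shortened by `D` at both ends lies inside the image of the pulse; the `1` is lost to
integer rounding. -/
theorem EvenlySpread.le_card {M K : ℕ} (hM : 0 < M) {D : ℝ} {s : Fin (M * K) → ℕ}
    (h : EvenlySpread M K D s) (m : Fin M) :
    (outputLength s / M : ℝ) - 2 * D - 1 ≤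
      ((window M (outputLength s) m).filter fun l => prefixLength s (m * K) ≤ l.val ∧
        l.val < prefixLength s ((m + 1) * K)).card := by
  have hMR : (0 : ℝ) < M := by exact_mod_cast hM
  set N : ℝ := outputLength s / M with hN
  have hN0 : 0 ≤ N := by positivity
  have hNM : (M : ℝ) * N = outputLength s := by rw [hN]; field_simp
  have h1 := abs_le.1 (h m m.isLt.le)
  have h2 := abs_le.1 (h (m + 1) m.isLt)
  have hm : ((m : ℕ) : ℝ) + 1 ≤ M := by exact_mod_cast m.isLt
  have hD : 0 ≤ D := (abs_nonneg _).trans (h m m.isLt.le)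
  push_cast at h2
  have hc := le_card_fin_filter (n := outputLength s) (a := m * N + D) (b := (m + 1) * N - D)
    (by positivity) (by nlinarith)
  refine le_trans (by linarith) (hc.trans ?_)
  refine Nat.cast_le.2 (Finset.card_le_card fun l hl => ?_)
  simp only [window, Finset.mem_filter, Finset.mem_univ, true_and] at hl ⊢
  refine ⟨⟨by linarith, by linarith⟩, ?_, ?_⟩
  · have : (prefixLength s (m * K) : ℝ) ≤ l := by linarith
    exact_mod_cast this
  · have : (l : ℝ) < prefixLength s ((m + 1) * K) := by linarith
    exact_mod_cast this

/-- The image of the pulse overshoots window `m` by at most `D` on either side, and a different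
window can meet only one of these strips. -/
theorem EvenlySpread.card_le {M K : ℕ} {D : ℝ} {s : Fin (M * K) → ℕ}
    (h : EvenlySpread M K D s) {m j : Fin M} (hj : j ≠ m) :
    (((window M (outputLength s) j).filter fun l => prefixLength s (m * K) ≤ l.val ∧
        l.val < prefixLength s ((m + 1) * K)).card : ℝ) ≤ D + 1 := by
  set N : ℝ := outputLength s / M with hN
  have hN0 : 0 ≤ N := by positivity
  have h1 := abs_le.1 (h m m.isLt.le)
  have h2 := abs_le.1 (h (m + 1) m.isLt)
  have hD : 0 ≤ D := (abs_nonneg _).trans (h m m.isLt.le)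
  push_cast at h2
  rcases lt_or_gt_of_ne hj with hlt | hlt
  · refine le_trans ?_ (card_fin_filter_le (n := outputLength s) (a := m * N - D) (b := m * N) hD
      (by linarith))
    refine Nat.cast_le.2 (Finset.card_le_card fun l hl => ?_)
    simp only [window, Finset.mem_filter, Finset.mem_univ, true_and] at hl ⊢
    obtain ⟨⟨_, h4⟩, h5, _⟩ := hl
    have h5' : (prefixLength s (m * K) : ℝ) ≤ l := by exact_mod_cast h5
    have hjm : ((j : ℕ) : ℝ) + 1 ≤ (m : ℕ) := by exact_mod_cast hlt
    have := mul_le_mul_of_nonneg_right hjm hN0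
    exact ⟨by linarith, by linarith⟩
  · refine le_trans ?_ (card_fin_filter_le (n := outputLength s) (a := (m + 1) * N)
      (b := (m + 1) * N + D) hD (by linarith))
    refine Nat.cast_le.2 (Finset.card_le_card fun l hl => ?_)
    simp only [window, Finset.mem_filter, Finset.mem_univ, true_and] at hl ⊢
    obtain ⟨⟨h3, _⟩, _, h6⟩ := hl
    have h6' : (l : ℝ) < prefixLength s ((m + 1) * K) := by exact_mod_cast h6
    have hjm : ((m : ℕ) : ℝ) + 1 ≤ (j : ℕ) := by exact_mod_cast hlt
    have := mul_le_mul_of_nonneg_right hjm hN0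
    exact ⟨by linarith, by linarith⟩

/-- The conditional error probability of a pulse position code given an evenly spread state
sequence. -/
theorem EvenlySpread.measureReal_decoder_ne_le {M K : ℕ} (hM : 0 < M) {a δ D : ℝ} (ha : 0 < a)
    (hδ : 0 < δ) (hδ' : δ < 1 / 4) {η : ℝ≥0} (hη : 0 < η) {s : Fin (M * K) → ℕ}
    (h : EvenlySpread M K D s) (hD : 2 * D + 2 ≤ δ * (outputLength s / M : ℝ)) (m : Fin M) {G : ℝ}
    (hG : G ≤ a ^ 2 * (outputLength s / M : ℝ) / (2 * (η : ℝ) ^ 2 * (1 + δ))) :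
    (noisyOutput η ((pulseCode M K hM a δ).codeword m) s).real
        {y | (pulseCode M K hM a δ).decoder (outputLength s) y ≠ m} ≤
      Real.exp (-(δ ^ 2 * G)) + M * Real.exp (-((1 - 3 * δ) ^ 2 * G)) := by
  have hMR : (0 : ℝ) < M := by exact_mod_cast hM
  have hηR : (0 : ℝ) < η := by exact_mod_cast hη
  have hD0 : 0 ≤ D := (abs_nonneg _).trans (h m m.isLt.le)
  set N : ℝ := outputLength s / M with hN
  have hN0 : 0 < N := by
    by_contra! hN0
    nlinarith
  set x := (pulseCode M K hM a δ).codeword m with hx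
  -- The right window has mean at least `(1 - δ) a N` and a wrong one at most `δ a N`, by `hD`. The
  -- threshold leaves margins `δ a N` and `(1 - 3 δ) a N`. The small first margin suffices for a
  -- single miss event, while the union over `M` windows needs nearly the full exponent.
  set τ := (1 - 2 * δ) * (a * N) with hτ
  set E : Fin M → Set (Fin (outputLength s) → ℝ) :=
    fun j => {y | τ ≤ ∑ l ∈ window M (outputLength s) j, y l} with hE
  have hsub : {y | (pulseCode M K hM a δ).decoder (outputLength s) y ≠ m} ⊆
      {y | ∑ l ∈ window M (outputLength s) m, y l < τ} ∪ ⋃ j ∈ Finset.univ.erase m, E j := by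
    intro y hy
    by_contra hn
    simp only [Set.mem_union, Set.mem_ofPred_eq, Set.mem_iUnion, Finset.mem_erase,
      Finset.mem_univ, and_true, not_or, not_lt, not_exists, hE] at hn
    exact hy (pick_eq hM hn.1 hn.2)
  have hw : ∀ j : Fin M, ((window M (outputLength s) j).card : ℝ) ≤ (1 + δ) * N := by
    intro j
    refine (card_fin_filter_le (w := N) hN0.le (le_of_eq (by ring))).trans ?_
    nlinarith
  have hpow : ((η ^ 2 : ℝ≥0) : ℝ) = (η : ℝ) ^ 2 := by push_cast; rfl
  have hexp : ∀ c : ℝ, c ^ 2 * G ≤ (c * (a * N)) ^ 2 / (2 * ((1 + δ) * N * (η ^ 2 : ℝ≥0))) := by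
    intro c
    rw [hpow]
    calc c ^ 2 * G ≤ c ^ 2 * (a ^ 2 * N / (2 * (η : ℝ) ^ 2 * (1 + δ))) := by gcongr
      _ = _ := by field_simp
  have hmiss : (noisyOutput η x s).real {y | ∑ l ∈ window M (outputLength s) m, y l < τ} ≤
      Real.exp (-(δ ^ 2 * G)) := by
    refine (measureReal_sum_lt_le (idcOutput x s) (v := η ^ 2) (by positivity) _
      (r := δ * (a * N)) (by positivity) (hw m) ?_).trans
      (Real.exp_le_exp.2 (neg_le_neg (hexp δ)))
    rw [hx, sum_window_idcOutput]
    have := mul_le_mul_of_nonneg_left (h.le_card hM m) ha.le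
    nlinarith [mul_le_mul_of_nonneg_left hD ha.le]
  have hfalse : ∀ j ∈ Finset.univ.erase m, (noisyOutput η x s).real (E j) ≤
      Real.exp (-((1 - 3 * δ) ^ 2 * G)) := by
    intro j hj
    refine (measureReal_le_sum_le (idcOutput x s) (v := η ^ 2) (by positivity) _
      (r := (1 - 3 * δ) * (a * N)) (mul_pos (by linarith) (by positivity)) (hw j) ?_).trans
      (Real.exp_le_exp.2 (neg_le_neg (hexp _)))
    rw [hx, sum_window_idcOutput]
    have := mul_le_mul_of_nonneg_left (h.card_le (Finset.ne_of_mem_erase hj)) ha.le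
    nlinarith [mul_le_mul_of_nonneg_left hD ha.le]
  refine (measureReal_mono hsub).trans ((measureReal_union_le _ _).trans (add_le_add hmiss ?_))
  refine (measureReal_biUnion_finset_le _ _).trans ((Finset.sum_le_sum hfalse).trans ?_)
  rw [Finset.sum_const, nsmul_eq_mul]
  refine mul_le_mul_of_nonneg_right ?_ (Real.exp_pos _).le
  have : (Finset.univ.erase m).card ≤ M := (Finset.card_le_univ _).trans (by simp)
  exact_mod_cast this

/-! ### Achievability -/

/-- The state sequences for which the length of the output of some initial segment of blocks is at
distance at least `c` from its mean, `μ` being the mean of one state. -/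
def deviating (M K : ℕ) (μ c : ℝ) : Set (Fin (M * K) → ℕ) :=
  ⋃ j ∈ Finset.range (M + 1), {s | c ≤ |(prefixLength s (j * K) : ℝ) - (j * K : ℕ) * μ|}

theorem stateLaw_deviating_le {ν : ProbabilityMeasure ℕ}
    (hν : MemLp (fun k : ℕ => (k : ℝ)) 2 (ν : Measure ℕ)) {v : ℝ}
    (hv : variance (fun k : ℕ => (k : ℝ)) (ν : Measure ℕ) ≤ v) (M K : ℕ) {c : ℝ} (hc : 0 < c) :
    stateLaw ν (M * K) (deviating M K (∫ k, (k : ℝ) ∂(ν : Measure ℕ)) c) ≤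
      ENNReal.ofReal ((M + 1) * (M * K * v / c ^ 2)) := by
  refine (measure_biUnion_finset_le _ _).trans ?_
  have h : ∀ j ∈ Finset.range (M + 1), stateLaw ν (M * K) {s | c ≤
      |(prefixLength s (j * K) : ℝ) - (j * K : ℕ) * ∫ k, (k : ℝ) ∂(ν : Measure ℕ)|} ≤
      ENNReal.ofReal (M * K * v / c ^ 2) := by
    intro j hj
    have hjM : j ≤ M := Nat.lt_succ_iff.1 (Finset.mem_range.1 hj)
    have hjK : j * K ≤ M * K := Nat.mul_le_mul_right _ hjM
    refine (measure_le_abs_prefixLength_sub_le hν hjK hc).trans (ENNReal.ofReal_le_ofReal ?_)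
    have h1 : ((j * K : ℕ) : ℝ) ≤ M * K := by exact_mod_cast hjK
    gcongr
    exact variance_nonneg _ _
  refine (Finset.sum_le_sum h).trans (le_of_eq ?_)
  rw [Finset.sum_const, Finset.card_range, ← ENNReal.ofReal_nsmul, nsmul_eq_mul]
  push_cast
  rfl

theorem abs_outputLength_div_sub_le {M K : ℕ} (hM : 0 < M) {μ c : ℝ}
    {s : Fin (M * K) → ℕ} (hs : s ∉ deviating M K μ c) :
    |(outputLength s / M : ℝ) - K * μ| ≤ c / M := by
  have hMR : (0 : ℝ) < M := by exact_mod_cast hM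
  simp only [deviating, Set.mem_iUnion, not_exists, Finset.mem_range, Set.mem_ofPred_eq,
    not_le] at hs
  have h := hs M (by omega)
  rw [prefixLength_eq_outputLength] at h
  have : (outputLength s / M : ℝ) - K * μ = (outputLength s - (M * K : ℕ) * μ) / M := by
    push_cast; field_simp
  rw [this, abs_div, abs_of_pos hMR]
  gcongr

/-- One `c` accounts for the deviation of the block boundary, the other for `j` times the error `c /
M` of the empirical window length. -/
theorem evenlySpread_of_notMem_deviating {M K : ℕ} (hM : 0 < M) {μ c : ℝ} (hc : 0 < c)
    {s : Fin (M * K) → ℕ} (hs : s ∉ deviating M K μ c) : EvenlySpread M K (2 * c) s := by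
  have hMR : (0 : ℝ) < M := by exact_mod_cast hM
  have hN := abs_le.1 (abs_outputLength_div_sub_le hM hs)
  intro j hj
  simp only [deviating, Set.mem_iUnion, not_exists, Finset.mem_range, Set.mem_ofPred_eq,
    not_le] at hs
  have h := abs_lt.1 (hs j (by omega))
  have hjM : (j : ℝ) ≤ M := by exact_mod_cast hj
  have hj0 : (0 : ℝ) ≤ j := Nat.cast_nonneg j
  have hjc : (j : ℝ) * (c / M) ≤ c := by
    rw [mul_div_assoc', div_le_iff₀ hMR]
    nlinarith
  have h1 := mul_le_mul_of_nonneg_left hN.1 hj0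
  have h2 := mul_le_mul_of_nonneg_left hN.2 hj0
  push_cast at h
  rw [abs_le]
  constructor <;> nlinarith

/-- The error probability of a pulse position code with blocks of `K` symbols. -/
theorem errorProb_pulseCode_le {M K : ℕ} (hM : 0 < M) {μ₁ a δ v : ℝ} (ha : 0 < a)
    (hδ : 0 < δ) (hδ' : δ < 1 / 4) (hK : 8 / δ ≤ K * μ₁) {η : ℝ≥0} (hη : 0 < η)
    {ν : ProbabilityMeasure ℕ} (hν : MemLp (fun k : ℕ => (k : ℝ)) 2 (ν : Measure ℕ))
    (hmean : μ₁ ≤ ∫ k, (k : ℝ) ∂(ν : Measure ℕ))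
    (hv : variance (fun k : ℕ => (k : ℝ)) (ν : Measure ℕ) ≤ v) {G : ℝ}
    (hG : G ≤ a ^ 2 * ((1 - δ) * (K * μ₁)) / (2 * (η : ℝ) ^ 2 * (1 + δ))) (m : Fin M) :
    (pulseCode M K hM a δ).errorProb ν η m ≤
      ENNReal.ofReal ((M + 1) * (M * K * v / (δ / 8 * (K * μ₁)) ^ 2)) +
        ENNReal.ofReal (Real.exp (-(δ ^ 2 * G)) + M * Real.exp (-((1 - 3 * δ) ^ 2 * G))) := by
  set μ := ∫ k, (k : ℝ) ∂(ν : Measure ℕ) with hμ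
  -- With `D = 2 c` one has `2 D + 2 = δ / 2 * (K μ₁) + 2 ≤ 3 / 4 * δ * (K μ₁)` by `hK`, which stays
  -- below `δ` times the window length.
  set c := δ / 8 * (K * μ₁) with hc
  have hKμ : 0 < K * μ₁ := lt_of_lt_of_le (by positivity) hK
  have hc0 : 0 < c := by positivity
  have hMR : (1 : ℝ) ≤ M := by exact_mod_cast hM
  set b := ENNReal.ofReal (Real.exp (-(δ ^ 2 * G)) + M * Real.exp (-((1 - 3 * δ) ^ 2 * G))) with hb
  have hpt : ∀ s : Fin (M * K) → ℕ,
      noisyOutput η ((pulseCode M K hM a δ).codeword m) s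
        {y | (pulseCode M K hM a δ).decoder (outputLength s) y ≠ m} ≤
      (deviating M K μ c).indicator 1 s + b := by
    intro s
    by_cases hs : s ∈ deviating M K μ c
    · rw [Set.indicator_of_mem hs]
      exact prob_le_one.trans le_self_add
    rw [Set.indicator_of_notMem hs, zero_add, ← ofReal_measureReal]
    refine ENNReal.ofReal_le_ofReal ?_
    have hN := (abs_le.1 (abs_outputLength_div_sub_le hM hs)).1
    have hcM : c / M ≤ c := div_le_self hc0.le hMR
    have hKmean : K * μ₁ ≤ K * μ := by gcongr
    have hN1 : (1 - δ / 8) * (K * μ₁) ≤ (outputLength s / M : ℝ) := by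
      rw [hc] at hN hcM
      linarith
    have hK' : 8 ≤ δ * (K * μ₁) := by
      rwa [div_le_iff₀ hδ, mul_comm] at hK
    refine (evenlySpread_of_notMem_deviating hM hc0 hs).measureReal_decoder_ne_le hM ha hδ hδ' hη
      ?_ m (hG.trans ?_)
    · have h1 := mul_le_mul_of_nonneg_left hN1 hδ.le
      have h2 : δ * (δ * (K * μ₁)) ≤ 1 / 4 * (δ * (K * μ₁)) := by gcongr
      rw [hc]
      linarith
    · have h3 : (1 - δ) * (K * μ₁) ≤ (outputLength s / M : ℝ) := by
        nlinarith
      gcongr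
  unfold Code.errorProb
  refine (lintegral_mono hpt).trans ?_
  rw [lintegral_add_right _ measurable_const, lintegral_const, measure_univ, mul_one,
    lintegral_indicator_one (Set.to_countable _).measurableSet]
  gcongr
  exact stateLaw_deviating_le hν hv M K hc0

/-- The expression is continuous in `δ` with value `ρ` at `0`. It is the false-alarm exponent in
units of `log M`, which must exceed `1` to beat the union bound. -/
theorem exists_pos_slack {ρ : ℝ} (hρ : 1 < ρ) :
    ∃ δ : ℝ, 0 < δ ∧ δ < 1 / 4 ∧ 1 < (1 - 3 * δ) ^ 2 * (ρ * (1 - δ) / (1 + δ)) := by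
  have hcont : ContinuousAt (fun δ : ℝ => (1 - 3 * δ) ^ 2 * (ρ * (1 - δ) / (1 + δ))) 0 := by
    refine ContinuousAt.mul (by fun_prop) (ContinuousAt.div (by fun_prop) (by fun_prop) (by norm_num))
  have h1 : ∀ᶠ δ : ℝ in nhdsWithin 0 (Set.Ioi 0),
      1 < (1 - 3 * δ) ^ 2 * (ρ * (1 - δ) / (1 + δ)) :=
    (hcont.tendsto.mono_left nhdsWithin_le_nhds).eventually_const_lt (by simpa using hρ)
  have h2 : ∀ᶠ δ : ℝ in nhdsWithin 0 (Set.Ioi 0), δ < 1 / 4 :=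
    (Filter.tendsto_id.mono_left nhdsWithin_le_nhds).eventually_lt_const (by norm_num)
  obtain ⟨δ, ⟨h1, h2⟩, h3⟩ := ((h1.and h2).and self_mem_nhdsWithin).exists
  exact ⟨δ, h3, h2, h1⟩

theorem eventually_exp_neg_mul_log_le {κ ε : ℝ} (hκ : 0 < κ) (hε : 0 < ε) :
    ∀ᶠ M : ℕ in Filter.atTop, Real.exp (-(κ * Real.log M)) ≤ ε := by
  have h : Filter.Tendsto (fun M : ℕ => Real.exp (-(κ * Real.log M))) Filter.atTop (nhds 0) :=
    Real.tendsto_exp_neg_atTop_nhds_zero.comp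
      ((Real.tendsto_log_atTop.comp tendsto_natCast_atTop_atTop).const_mul_atTop hκ)
  exact h.eventually_le_const hε

theorem achievable_idcClass {μ₁ v R : ℝ} {η : ℝ≥0} (hμ₁ : 0 < μ₁) (hη : 0 < η)
    (U V : Set ℝ) (hU : ∀ μ ∈ U, μ₁ ≤ μ) (hV : ∀ w ∈ V, w ≤ v) (hR : 0 < R)
    (hRC : R < μ₁ / (2 * (η : ℝ) ^ 2 * Real.log 2)) : Achievable (idcClass U V) η R := by
  intro ε hε
  have hηR : (0 : ℝ) < η := by exact_mod_cast hη
  have hl2 : 0 < Real.log 2 := Real.log_pos one_lt_two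
  set ρ := μ₁ / (2 * (η : ℝ) ^ 2 * Real.log 2) / R with hρdef
  have hρ : 1 < ρ := (one_lt_div hR).2 hRC
  obtain ⟨δ, hδ, hδ', hδρ⟩ := exists_pos_slack hρ
  set g := ρ * (1 - δ) / (1 + δ) with hg
  have hg0 : 0 < g := div_pos (mul_pos (by linarith) (by linarith)) (by linarith)
  -- The Gaussian error terms are `M ^ (-δ² g)` for a miss and `M ^ (1 - (1 - 3 δ)² g)` for a false
  -- alarm.
  have hev := (eventually_exp_neg_mul_log_le (mul_pos (pow_pos hδ 2) hg0)
    (show 0 < ε / 4 by linarith)).and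
      (eventually_exp_neg_mul_log_le (sub_pos.2 hδρ) (show 0 < ε / 4 by linarith))
  obtain ⟨M₀, hM₀⟩ := Filter.eventually_atTop.1 hev
  refine ⟨max M₀ 2, fun M hM => ?_⟩
  obtain ⟨hsmall₁, hsmall₂⟩ := hM₀ M ((le_max_left _ _).trans hM)
  have hM2 : 2 ≤ M := (le_max_right _ _).trans hM
  have hM0 : 0 < M := by omega
  have hMR : (0 : ℝ) < M := by exact_mod_cast hM0
  have hlogM : 0 < Real.log M := Real.log_pos (by exact_mod_cast hM2)
  set P := Real.logb 2 M / R with hP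
  have hP0 : 0 < P := div_pos (div_pos hlogM hl2) hR
  -- The first bound makes blocks long enough for integer rounding to be negligible. The second
  -- brings the Chebyshev term, which is a constant over `K` once `M` is fixed, below `ε / 2`.
  obtain ⟨K, hK⟩ := exists_nat_ge
    (max (8 / δ / μ₁) ((M + 1) * M * v / (δ / 8 * μ₁) ^ 2 / (ε / 2)))
  have hK₁ : 8 / δ ≤ K * μ₁ := (div_le_iff₀ hμ₁).1 ((le_max_left _ _).trans hK)
  have hK₂ := (div_le_iff₀ (half_pos hε)).1 ((le_max_right _ _).trans hK)
  have hK0 : (0 : ℝ) < K := by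
    by_contra! hK0
    have : 0 < 8 / δ := by positivity
    nlinarith
  set a := √(P / K) with ha
  have ha0 : 0 < a := Real.sqrt_pos.2 (div_pos hP0 hK0)
  have ha2 : a ^ 2 = P / K := Real.sq_sqrt (div_pos hP0 hK0).le
  refine ⟨M * K, P, pulseCode M K hM0 a δ, hP0, ⟨fun m => ?_, fun ν hν => ?_⟩, ?_⟩
  · rw [energy_pulseCode, ha2]
    exact le_of_eq (by field_simp)
  · obtain ⟨hmem, hmean, hvar⟩ := hν
    -- Equality holds: `a² K = P = log₂ M / R` gives `a² K μ₁ / (2 η²) = ρ log M`.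
    have hG : g * Real.log M ≤ a ^ 2 * ((1 - δ) * (K * μ₁)) / (2 * (η : ℝ) ^ 2 * (1 + δ)) := by
      have h1δ : (1 + δ) ≠ 0 := by linarith
      refine le_of_eq ?_
      rw [ha2, hP, Real.logb, hg, hρdef]
      field_simp
    have herr : ∀ m, (pulseCode M K hM0 a δ).errorProb ν η m ≤ ENNReal.ofReal ε := by
      intro m
      refine (errorProb_pulseCode_le hM0 ha0 hδ hδ' hK₁ hη hmem (hU _ hmean) (hV _ hvar) hG
        m).trans ?_
      have h1 : (M + 1) * (M * K * v / (δ / 8 * (K * μ₁)) ^ 2) ≤ ε / 2 := by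
        have : (M + 1) * (M * K * v / (δ / 8 * (K * μ₁)) ^ 2) =
            (M + 1) * M * v / (δ / 8 * μ₁) ^ 2 / K := by
          field_simp
        rw [this, div_le_iff₀ hK0, mul_comm (ε / 2)]
        exact hK₂
      have h2 : Real.exp (-(δ ^ 2 * (g * Real.log M))) +
          M * Real.exp (-((1 - 3 * δ) ^ 2 * (g * Real.log M))) ≤ ε / 2 := by
        have e1 : δ ^ 2 * (g * Real.log M) = δ ^ 2 * g * Real.log M := by ring
        have e2 : M * Real.exp (-((1 - 3 * δ) ^ 2 * (g * Real.log M))) =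
            Real.exp (-(((1 - 3 * δ) ^ 2 * g - 1) * Real.log M)) := by
          nth_rewrite 1 [← Real.exp_log hMR]
          rw [← Real.exp_add]
          congr 1
          ring
        rw [e1, e2]
        linarith
      calc _ ≤ ENNReal.ofReal (ε / 2) + ENNReal.ofReal (ε / 2) :=
            add_le_add (ENNReal.ofReal_le_ofReal h1) (ENNReal.ofReal_le_ofReal h2)
        _ = ENNReal.ofReal ε := by
            rw [← ENNReal.ofReal_add (by positivity) (by positivity), add_halves]
    unfold Code.avgErrorProb
    refine ENNReal.div_le_of_le_mul ?_
    refine (Finset.sum_le_sum fun m _ => herr m).trans (le_of_eq ?_)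
    rw [Finset.sum_const, Finset.card_univ, Fintype.card_fin, nsmul_eq_mul, mul_comm]
  · rw [hP]
    have : 0 < Real.logb 2 M := div_pos hlogM hl2
    refine le_of_eq ?_
    field_simp

/-! ### Capacities per unit energy -/

theorem Achievable.mono {S S' : Set (ProbabilityMeasure ℕ)} (hS : S ⊆ S') {η : ℝ≥0} {R : ℝ}
    (h : Achievable S' η R) : Achievable S η R := by
  intro ε hε
  obtain ⟨M₀, hM₀⟩ := h ε hε
  refine ⟨M₀, fun M hM => ?_⟩
  obtain ⟨T, P, C, hP, hC, hrate⟩ := hM₀ M hM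
  exact ⟨T, P, C, hP, ⟨hC.1, fun ν hν => hC.2 ν (hS hν)⟩, hrate⟩

theorem capacityPerUnitEnergy_anti {S S' : Set (ProbabilityMeasure ℕ)} (hS : S ⊆ S') (η : ℝ≥0) :
    capacityPerUnitEnergy S' η ≤ capacityPerUnitEnergy S η :=
  sSup_le_sSup (Set.image_mono fun _ h => Achievable.mono hS h)

theorem capacityPerUnitEnergy_singleton_le {ν : ProbabilityMeasure ℕ} {η : ℝ≥0} (hη : η ≠ 0)
    (hν : MemLp (fun k : ℕ => (k : ℝ)) 2 (ν : Measure ℕ)) :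
    capacityPerUnitEnergy {ν} η ≤
      (((∫ k, (k : ℝ) ∂(ν : Measure ℕ)) / (2 * (η : ℝ) ^ 2 * Real.log 2) : ℝ) : EReal) := by
  refine sSup_le ?_
  rintro _ ⟨R, hR, rfl⟩
  exact EReal.coe_le_coe_iff.2 (Achievable.le_of_memLp hR hη hν)

theorem le_capacityPerUnitEnergy_idcClass {μ₁ v : ℝ} {η : ℝ≥0} (hμ₁ : 0 < μ₁) (hη : 0 < η)
    (U V : Set ℝ) (hU : ∀ μ ∈ U, μ₁ ≤ μ) (hV : ∀ w ∈ V, w ≤ v) :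
    ((μ₁ / (2 * (η : ℝ) ^ 2 * Real.log 2) : ℝ) : EReal) ≤
      capacityPerUnitEnergy (idcClass U V) η := by
  have hηR : (0 : ℝ) < η := by exact_mod_cast hη
  have hl2 : 0 < Real.log 2 := Real.log_pos one_lt_two
  have hC : 0 < μ₁ / (2 * (η : ℝ) ^ 2 * Real.log 2) := by positivity
  refine EReal.ge_of_forall_gt_iff_ge.1 fun R hR => ?_
  have hR' := EReal.coe_lt_coe_iff.1 hR
  -- Achievability is proved for positive rates only, so a rate above `max 0 R` is inserted.
  obtain ⟨R', h1, h2⟩ := exists_between (max_lt hC hR')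
  refine (EReal.coe_le_coe_iff.2 ((le_max_right 0 R).trans h1.le)).trans (le_sSup ⟨R', ?_, rfl⟩)
  exact achievable_idcClass hμ₁ hη U V hU hV ((le_max_left 0 R).trans_lt h1) h2

end SyncChannel

end

theorem theorem2 (μ₁ μ₂ σ : ℝ) (η : ℝ≥0) (hμ₁ : 0 < μ₁) (hμ : μ₁ ≤ μ₂) (hη : 0 < η)
    (hne : (SyncChannel.idcClass {μ₁} (Set.Icc 0 (σ ^ 2))).Nonempty) :
    SyncChannel.capacityPerUnitEnergy
        (SyncChannel.idcClass (Set.Icc μ₁ μ₂) (Set.Icc 0 (σ ^ 2))) η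
      = ((μ₁ / (2 * (η : ℝ) ^ 2 * Real.log 2) : ℝ) : EReal) ∧
    IsLeast
      ((fun ν : ProbabilityMeasure ℕ => SyncChannel.capacityPerUnitEnergy {ν} η) ''
        SyncChannel.idcClass (Set.Icc μ₁ μ₂) (Set.Icc 0 (σ ^ 2)))
      ((μ₁ / (2 * (η : ℝ) ^ 2 * Real.log 2) : ℝ) : EReal) := by
  obtain ⟨ν₀, hmem, hmean, hvar⟩ := hne
  have hmean' : ∫ k, (k : ℝ) ∂(ν₀ : Measure ℕ) = μ₁ := hmean
  have hν₀ : ν₀ ∈ SyncChannel.idcClass (Set.Icc μ₁ μ₂) (Set.Icc 0 (σ ^ 2)) :=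
    ⟨hmem, by rw [hmean']; exact ⟨le_rfl, hμ⟩, hvar⟩
  have hlow := SyncChannel.le_capacityPerUnitEnergy_idcClass hμ₁ hη (Set.Icc μ₁ μ₂)
    (Set.Icc 0 (σ ^ 2)) (fun _ h => h.1) fun _ h => h.2
  have hup := SyncChannel.capacityPerUnitEnergy_singleton_le hη.ne' hmem
  rw [hmean'] at hup
  have hanti : ∀ ν ∈ SyncChannel.idcClass (Set.Icc μ₁ μ₂) (Set.Icc 0 (σ ^ 2)),
      SyncChannel.capacityPerUnitEnergy
        (SyncChannel.idcClass (Set.Icc μ₁ μ₂) (Set.Icc 0 (σ ^ 2))) η ≤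
      SyncChannel.capacityPerUnitEnergy {ν} η := fun ν hν =>
    SyncChannel.capacityPerUnitEnergy_anti (Set.singleton_subset_iff.2 hν) η
  -- The chain `C ≤ compound ≤ capacity of ν₀ ≤ C`, with `C` the claimed value, collapses to
  -- equalities. This gives the compound capacity and shows that `ν₀` attains the minimum.
  refine ⟨le_antisymm ((hanti ν₀ hν₀).trans hup) hlow,
    ⟨ν₀, hν₀, le_antisymm hup (hlow.trans (hanti ν₀ hν₀))⟩, ?_⟩
  rintro _ ⟨ν, hν, rfl⟩
  exact hlow.trans (hanti ν hν)
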